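/- Let $\overline{\mathbb C}=\mathbb C\cup\{\infty\}$ carry the chordal metric $d(z,w)=|z-w|(1+|z|^2)^{-1/2}(1+|w|^2)^{-1/2}$, $d(z,\infty)=(1+|z|^2)^{-1/2}$, and let the nonempty compact subsets of $\overline{\mathbb C}$ carry the associated Hausdorff distance $\overline\delta_H$. Let $e\subset\overline{\mathbb C}$ be a finite set and let $\varphi$ be a real-valued function that is harmonic in $\overline{\mathbb C}\setminus e$ (at $\infty$, if $\infty\notin e$: harmonic in the coordinate $1/z$). For a compact $K\subset\overline{\mathbb C}$ let $\mathcal M(K,\varphi)$ be the set of Borel probability measures $\mu$ supported in $K$ with $\int\log(1+|z|)\,d\mu<\infty$ (so $\mu(\{\infty\})=0$), with $\mathcal E(\mu)=\iint\log\frac1{|z-w|}\,d\mu(z)\,d\mu(w)<+\infty$, and with $\varphi\in L^1(\mu)$; put $$\mathcal E_\varphi(\mu)=\mathcal E(\mu)+2\int\varphi\,d\mu,\qquad \mathcal E_\varphi[K]=\inf_{\mu\in\mathcal M(K,\varphi)}\mathcal E_\varphi(\mu)\in[-\infty,+\infty],$$ where $\inf\emptyset=+\infty$. **Corollary 3.3.**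 Let $\mathcal T$ be a class of nonempty compact subsets of $\overline{\mathbb C}$ such that 1. $\mathcal T$ is closed in the metric $\overline\delta_H$; 2. for some natural number $s$, every $\Gamma\in\mathcal T$ has at most $s$ connected components; 3. there is $\Gamma\in\mathcal T$ with $\mathcal E_\varphi[\Gamma]>-\infty$, and $\sup_{\Gamma\in\mathcal T}\mathcal E_\varphi[\Gamma]<+\infty$. Then there exists $S\in\mathcal T$ with $$\mathcal E_\varphi[S]=\sup_{\Gamma\in\mathcal T}\mathcal E_\varphi[\Gamma].$$ No further condition is imposed on $\mathcal T$; in particular neither openness under local variations fixing a finite set nor the possibility of removing a common disc from the members of a convergent sequence is assumed. -/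

import Mathlib

open scoped ENNReal OnePoint

noncomputable section

namespace MaxMinEnergy

/-- The Riemann sphere, as the one-point compactification of the complex plane. -/
abbrev Sphere : Type := OnePoint ℂ

/-- The chordal distance `|z - w| (1 + |z|²)^(-1/2) (1 + |w|²)^(-1/2)` on the sphere,
extended by continuity to the point at infinity. -/
def chordalDist : Sphere → Sphere → ℝ
  | .some z, .some w => ‖z - w‖ / (√(1 + ‖z‖ ^ 2) * √(1 + ‖w‖ ^ 2))
  | .some z, ∞ => 1 / √(1 + ‖z‖ ^ 2)
  | ∞, .some w => 1 / √(1 + ‖w‖ ^ 2)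
  | ∞, ∞ => 0

/-- The open `δ`-neighbourhood of `K` in the chordal metric. -/
def chordalNhd (K : Set Sphere) (δ : ℝ) : Set Sphere :=
  {z | ∃ ζ ∈ K, chordalDist z ζ < δ}

/-- The Hausdorff distance of two (nonempty compact) sets in the chordal metric.
As the chordal metric is bounded, the infimum is over a nonempty set
whenever both sets are nonempty. -/
def hausdorffDistance (K₁ K₂ : Set Sphere) : ℝ :=
  sInf {δ : ℝ | 0 < δ ∧ K₁ ⊆ chordalNhd K₂ δ ∧ K₂ ⊆ chordalNhd K₁ δ}

/-- A class `T` of sets is closed, in the space of all nonempty compact subsets of the sphere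
with the chordal Hausdorff distance. -/
def HausdorffClosed (T : Set (Set Sphere)) : Prop :=
  ∀ K : Set Sphere, IsCompact K → K.Nonempty →
    (∀ ε : ℝ, 0 < ε → ∃ Γ ∈ T, hausdorffDistance Γ K < ε) → K ∈ T

/-- The chart `w ↦ 1 / w` of the sphere at infinity, sending `0` to `∞`. -/
def chartAtInfty (w : ℂ) : Sphere :=
  if w = 0 then ∞ else ((w⁻¹ : ℂ) : Sphere)

/-- `φ` is harmonic at every point of the open set `U` of the sphere;
at infinity this is harmonicity in the coordinate `1 / z`. -/
def HarmonicOnSphere (φ : Sphere → ℝ) (U : Set Sphere) : Prop :=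
  (∀ z : ℂ, (z : Sphere) ∈ U →
    InnerProductSpace.HarmonicAt (fun w : ℂ => φ (w : Sphere)) z) ∧
  ((∞ : Sphere) ∈ U →
    InnerProductSpace.HarmonicAt (fun w : ℂ => φ (chartAtInfty w)) 0)

/-- The logarithmic kernel `log (1 / |z - w|)`, equal to `+∞` on the diagonal. -/
def logKernel (z w : ℂ) : EReal := -ENNReal.log ‖z - w‖ₑ

/-- The logarithmic energy `∬ log (1 / |z - w|) dμ(z) dμ(w)`, the integral of the positive part
minus the integral of the negative part. The second is finite for a finite measure that
integrates `log (1 + |z|)`, so that the energy is then a well-defined element of `(-∞, +∞]`. -/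
def logEnergy (μ : MeasureTheory.Measure ℂ) : EReal :=
  ((∫⁻ z, ∫⁻ w, (logKernel z w).toENNReal ∂μ ∂μ : ℝ≥0∞) : EReal) -
    ((∫⁻ z, ∫⁻ w, (-logKernel z w).toENNReal ∂μ ∂μ : ℝ≥0∞) : EReal)

/-- The unit measures on `K` of finite logarithmic energy that integrate `φ`.
A measure on the sphere that integrates `log (1 + |z|)` has no mass at infinity,
hence is a measure on the plane. -/
structure Admissible (φ : Sphere → ℝ) (K : Set Sphere)
    (μ : MeasureTheory.Measure ℂ) : Prop where
  isProbability : MeasureTheory.IsProbabilityMeasure μ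
  supported : μ {z : ℂ | (z : Sphere) ∉ K} = 0
  log_integrable : ∫⁻ z, ENNReal.ofReal (Real.log (1 + ‖z‖)) ∂μ < ⊤
  finite_energy : logEnergy μ < ⊤
  field_integrable : MeasureTheory.Integrable (fun z : ℂ => φ (z : Sphere)) μ

/-- The total energy of `μ` in the external field `φ`. -/
def weightedEnergy (φ : Sphere → ℝ) (μ : MeasureTheory.Measure ℂ) : EReal :=
  logEnergy μ + ((2 * ∫ z : ℂ, φ (z : Sphere) ∂μ : ℝ) : EReal)

/-- The equilibrium energy of `K` in the external field `φ`: the infimum of the total energies,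
in `[-∞, +∞]`, with value `+∞` if there is no admissible measure
(that is, if `K` has capacity zero). -/
def equilibriumEnergy (φ : Sphere → ℝ) (K : Set Sphere) : EReal :=
  ⨅ (μ : MeasureTheory.Measure ℂ) (_ : Admissible φ K μ), weightedEnergy φ μ

end MaxMinEnergy

end

noncomputable section

namespace MaxMinEnergy

open MeasureTheory Filter Topology Set

/-! The heart is upper semicontinuity: if compact sets `Γ n` with at most `s` components converge to
`S`, a limit of their equilibrium energies is at most that of `S`
(`le_equilibriumEnergy_of_tendsto`). Applied to a maximizing sequence, which has a Hausdorff
convergent subsequence, this gives a maximizer.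

For semicontinuity, an admissible measure on `S` is transplanted to `Γ n`. Choose a base point in
each component of `Γ n` and let the base points converge as well. Finite energy excludes atoms, so
the measure may first be cut down to a compact `A` away from infinity, from `e` and from the limits
of the base points. A point of `A` is near some `x` in `Γ n`, and the component of `x` reaches a
base point far away; being connected, it meets every small circle about `x`. Selecting one point on
each circle of radius below `h` replaces a point of `A` by a probability measure on `Γ n` that is
uniform in the distance to `x`.

Such a radial spread has potential at most log (1/h) plus an absolute constant, just as a segment of
length `h` does. Hence the averaged kernel is dominated by the original kernel plus a constant,
independently of `h` (`posKernel_spread_bound`), and dominated convergence shows that the energies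
of the spreads tend to that of the measure (`le_weightedEnergy_of_isCompact`). -/

/-! ### Chordal metric and Hausdorff compactness -/

/-- The stereographic embedding of the sphere, as a sphere of radius `1 / 2`. -/
def stereo : Sphere → WithLp 2 (ℂ × ℝ)
  | .some z => WithLp.toLp 2 (((1 + ‖z‖ ^ 2)⁻¹ : ℝ) • z, ‖z‖ ^ 2 / (1 + ‖z‖ ^ 2))
  | ∞ => WithLp.toLp 2 (0, 1)

lemma stereo_coe_fst (z : ℂ) : (stereo z).fst = ((1 + ‖z‖ ^ 2)⁻¹ : ℝ) • z := rfl

lemma stereo_coe_snd (z : ℂ) : (stereo z).snd = ‖z‖ ^ 2 / (1 + ‖z‖ ^ 2) := rfl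

lemma stereo_infty_fst : (stereo ∞).fst = 0 := rfl

lemma stereo_infty_snd : (stereo ∞).snd = 1 := rfl

lemma dist_stereo (a b : Sphere) : dist (stereo a) (stereo b) = chordalDist a b := by
  have key : ∀ z : ℂ, dist (stereo z) (stereo ∞) = 1 / √(1 + ‖z‖ ^ 2) := by
    intro z
    have h1 : (0 : ℝ) < 1 + ‖z‖ ^ 2 := by positivity
    have e : chordalDist z ∞ = 1 / √(1 + ‖z‖ ^ 2) := rfl
    rw [WithLp.prod_dist_eq_of_L2, ← Real.sqrt_one, ← Real.sqrt_div zero_le_one, Real.sqrt_one]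
    congr 1
    simp only [stereo_coe_fst, stereo_coe_snd, stereo_infty_fst, stereo_infty_snd, dist_eq_norm,
      sub_zero, norm_smul, Real.norm_eq_abs, sq_abs, mul_pow]
    field_simp
    ring
  induction a using OnePoint.rec with
  | infty =>
    induction b using OnePoint.rec with
    | infty => simp [chordalDist]
    | coe w => rw [dist_comm, key]; rfl
  | coe z =>
    induction b using OnePoint.rec with
    | infty => rw [key]; rfl
    | coe w =>
      have e : chordalDist z w = ‖z - w‖ / (√(1 + ‖z‖ ^ 2) * √(1 + ‖w‖ ^ 2)) := rfl
      have hz : (0 : ℝ) < 1 + ‖z‖ ^ 2 := by positivity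
      have hw : (0 : ℝ) < 1 + ‖w‖ ^ 2 := by positivity
      rw [e, WithLp.prod_dist_eq_of_L2, ← Real.sqrt_mul hz.le,
        ← Real.sqrt_sq (norm_nonneg (z - w)), ← Real.sqrt_div (by positivity)]
      congr 1
      simp only [stereo_coe_fst, stereo_coe_snd, dist_eq_norm, Real.norm_eq_abs, sq_abs]
      rw [Complex.sq_norm] at hz hw
      simp only [Complex.sq_norm, Complex.normSq_apply, Complex.sub_re, Complex.sub_im,
        Complex.real_smul, Complex.mul_re, Complex.mul_im, Complex.ofReal_re,
        Complex.ofReal_im, zero_mul, sub_zero, add_zero] at hz hw ⊢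
      field_simp
      ring

lemma chordalDist_eq_zero {a b : Sphere} (h : chordalDist a b = 0) : a = b := by
  have pos : ∀ z : ℂ, √(1 + ‖z‖ ^ 2) ≠ 0 := fun z => by positivity
  induction a using OnePoint.rec with
  | infty =>
    induction b using OnePoint.rec with
    | infty => rfl
    | coe w =>
      exact absurd h (one_div_ne_zero (pos w))
  | coe z =>
    induction b using OnePoint.rec with
    | infty => exact absurd h (one_div_ne_zero (pos z))
    | coe w =>
      have e : chordalDist z w = ‖z - w‖ / (√(1 + ‖z‖ ^ 2) * √(1 + ‖w‖ ^ 2)) := rfl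
      rw [e, div_eq_zero_iff] at h
      rcases h with h | h
      · rw [norm_eq_zero, sub_eq_zero] at h
        rw [h]
      · exact absurd h (mul_ne_zero (pos z) (pos w))

/-- A continuous injection of a compact space into a Hausdorff space is an embedding. The chordal
metric pulled back along it therefore induces the topology of the one-point compactification, and
compactness has the same meaning for both. -/
lemma isEmbedding_stereo : IsEmbedding stereo := by
  have hc : Continuous stereo := by
    rw [OnePoint.continuous_iff]
    constructor
    · rw [tendsto_iff_dist_tendsto_zero, coclosedCompact_eq_cocompact]
      simp only [dist_stereo]
      have h1 : Tendsto (fun z : ℂ => √(1 + ‖z‖ ^ 2)) (cocompact ℂ) atTop := by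
        refine tendsto_atTop_mono (fun z => ?_) (tendsto_norm_cocompact_atTop (E := ℂ))
        exact Real.le_sqrt_of_sq_le (by linarith)
      refine h1.inv_tendsto_atTop.congr fun z => ?_
      simp [chordalDist]
    · have : Continuous fun z : ℂ =>
          (((1 + ‖z‖ ^ 2)⁻¹ : ℝ) • z, ‖z‖ ^ 2 / (1 + ‖z‖ ^ 2)) := by
        have h : ∀ z : ℂ, 1 + ‖z‖ ^ 2 ≠ 0 := fun z => by positivity
        fun_prop (disch := exact h _)
      exact (WithLp.prod_continuous_toLp 2 ℂ ℝ).comp this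
  refine (hc.isClosedEmbedding fun a b h => chordalDist_eq_zero ?_).isEmbedding
  rw [← dist_stereo, h, dist_self]

/-- The chordal metric. -/
abbrev chordalMetric : MetricSpace Sphere := isEmbedding_stereo.comapMetricSpace stereo

lemma chordalMetric_dist (a b : Sphere) :
    @dist Sphere chordalMetric.toDist a b = chordalDist a b := dist_stereo a b

/-- The nonempty compact subsets of a compact metric space form a compact space. The one-sided
inclusion is recorded separately because it is the part of the convergence that semicontinuity uses.
-/
lemma exists_subseq_hausdorff (Γ : ℕ → Set Sphere)
    (hΓ : ∀ n, IsCompact (Γ n) ∧ (Γ n).Nonempty) :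
    ∃ K : Set Sphere, IsCompact K ∧ K.Nonempty ∧ ∃ ψ : ℕ → ℕ, StrictMono ψ ∧ ∀ ε : ℝ, 0 < ε →
      ∀ᶠ n in atTop, hausdorffDistance (Γ (ψ n)) K < ε ∧ K ⊆ chordalNhd (Γ (ψ n)) ε := by
  let _ := chordalMetric
  let C : ℕ → TopologicalSpace.NonemptyCompacts Sphere := fun n => ⟨⟨Γ n, (hΓ n).1⟩, (hΓ n).2⟩
  obtain ⟨K, -, ψ, hψ, hK⟩ := isCompact_univ.tendsto_subseq (x := C) (fun n => mem_univ _)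
  refine ⟨K, K.isCompact, K.nonempty, ψ, hψ, fun ε hε => ?_⟩
  filter_upwards [(Metric.tendsto_nhds.1 hK) (ε / 2) (half_pos hε)] with n hn
  rw [Metric.NonemptyCompacts.dist_eq] at hn
  have fin : Metric.hausdorffEDist (Γ (ψ n)) (K : Set Sphere) ≠ ⊤ :=
    Metric.hausdorffEDist_ne_top_of_nonempty_of_bounded (hΓ _).2 K.nonempty
      (hΓ _).1.isBounded K.isCompact.isBounded
  have h1 : Γ (ψ n) ⊆ chordalNhd K (ε / 2) := by
    intro x hx
    obtain ⟨y, hy, hxy⟩ := Metric.exists_dist_lt_of_hausdorffDist_lt hx hn fin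
    exact ⟨y, hy, (chordalMetric_dist _ _).symm.trans_lt hxy⟩
  have h2 : (K : Set Sphere) ⊆ chordalNhd (Γ (ψ n)) (ε / 2) := by
    intro x hx
    obtain ⟨y, hy, hxy⟩ := Metric.exists_dist_lt_of_hausdorffDist_lt' hx hn fin
    rw [dist_comm] at hxy
    exact ⟨y, hy, (chordalMetric_dist _ _).symm.trans_lt hxy⟩
  constructor
  · have hb : BddBelow {δ : ℝ | 0 < δ ∧ Γ (ψ n) ⊆ chordalNhd K δ ∧
        (K : Set Sphere) ⊆ chordalNhd (Γ (ψ n)) δ} := ⟨0, fun δ hδ => hδ.1.le⟩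
    exact (csInf_le hb ⟨half_pos hε, h1, h2⟩).trans_lt (half_lt_self hε)
  · intro x hx
    obtain ⟨y, hy, hxy⟩ := h2 hx
    exact ⟨y, hy, hxy.trans (half_lt_self hε)⟩

/-- On bounded subsets of the plane, chordal closeness implies Euclidean closeness. -/
lemma exists_chordal_radius (R h : ℝ) (hh : 0 < h) : ∃ δ : ℝ, 0 < δ ∧ ∀ p : ℂ, ‖p‖ ≤ R →
    ∀ y : Sphere, chordalDist p y < δ → ∃ x : ℂ, y = x ∧ ‖x - p‖ < h := by
  have hM : (0 : ℝ) < √(1 + R ^ 2) := by positivity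
  set M := √(1 + R ^ 2) with hMdef
  -- The first bound excludes infinity and forces `‖p - x‖ ≤ M`; the product of the two square roots
  -- is then at most `2 * M ^ 2`, and the second bound gives `h`.
  refine ⟨min (1 / (2 * M)) (h / (2 * M ^ 2)), by positivity, fun p hp y hy => ?_⟩
  have hpM : √(1 + ‖p‖ ^ 2) ≤ M := Real.sqrt_le_sqrt (by gcongr)
  have hp0 : 0 < √(1 + ‖p‖ ^ 2) := by positivity
  have hy1 := hy.trans_le (min_le_left _ _)
  have hy2 := hy.trans_le (min_le_right _ _)
  induction y using OnePoint.rec with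
  | infty =>
    have e : chordalDist p ∞ = 1 / √(1 + ‖p‖ ^ 2) := rfl
    rw [e, div_lt_div_iff₀ hp0 (by positivity)] at hy1
    linarith
  | coe x =>
    refine ⟨x, rfl, ?_⟩
    have e : chordalDist p x = ‖p - x‖ / (√(1 + ‖p‖ ^ 2) * √(1 + ‖x‖ ^ 2)) := rfl
    have hx0 : 0 < √(1 + ‖x‖ ^ 2) := by positivity
    have hx : √(1 + ‖x‖ ^ 2) ≤ M + ‖p - x‖ := by
      have h1 : ‖x‖ ≤ ‖p‖ + ‖p - x‖ := by
        have := norm_sub_le p (p - x)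
        rwa [sub_sub_cancel] at this
      have h2 : ‖p‖ ≤ √(1 + ‖p‖ ^ 2) := Real.le_sqrt_of_sq_le (by linarith)
      refine le_trans ?_ (add_le_add_left hpM _)
      rw [Real.sqrt_le_left (by positivity)]
      have h3 := Real.sq_sqrt (show 0 ≤ 1 + ‖p‖ ^ 2 by positivity)
      nlinarith [norm_nonneg x, norm_nonneg p, norm_nonneg (p - x)]
    have hprod : √(1 + ‖p‖ ^ 2) * √(1 + ‖x‖ ^ 2) ≤ M * (M + ‖p - x‖) := by gcongr
    rw [e, div_lt_div_iff₀ (by positivity) (by positivity)] at hy1 hy2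
    rw [norm_sub_rev]
    have n0 := norm_nonneg (p - x)
    have h4 : ‖p - x‖ ≤ M := by nlinarith
    have h5 : M * (M + ‖p - x‖) ≤ 2 * M ^ 2 := by nlinarith
    have h6 : h * (√(1 + ‖p‖ ^ 2) * √(1 + ‖x‖ ^ 2)) ≤ h * (2 * M ^ 2) := mul_le_mul_of_nonneg_left (hprod.trans h5) hh.le
    exact lt_of_mul_lt_mul_right (hy2.trans_le h6) (by positivity)

/-! ### Selections on circles and radial spreads -/

/-- A closed set that meets every circle of radius `r ∈ (0, h)` about `x` contains a measurable
selection of points of these circles. -/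
lemma exists_measurable_radial_selection {A : Set ℂ} (hA : IsClosed A) (x : ℂ) {h : ℝ}
    (hx : ∀ r ∈ Ioo 0 h, ∃ z ∈ A, ‖z - x‖ = r) :
    ∃ γ : ℝ → ℂ, Measurable γ ∧ ∀ r ∈ Ioo 0 h, γ r ∈ A ∧ ‖γ r - x‖ = r := by
  set E : ℝ × ℝ → ℂ := fun p => x + p.1 * Complex.exp (p.2 * Complex.I) with hE
  have hEc : Continuous E := by fun_prop
  set Θ : ℝ → Set ℝ := fun r => {θ | θ ∈ Icc (-Real.pi) Real.pi ∧ E (r, θ) ∈ A} with hΘ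
  have hcomp : ∀ r, IsCompact (Θ r) := fun r =>
    isCompact_Icc.inter_right (hA.preimage (by fun_prop : Continuous fun θ => E (r, θ)))
  have hne : ∀ r ∈ Ioo 0 h, (Θ r).Nonempty := by
    intro r hr
    obtain ⟨z, hz, hzr⟩ := hx r hr
    refine ⟨(z - x).arg, ⟨(Complex.neg_pi_lt_arg _).le, Complex.arg_le_pi _⟩, ?_⟩
    have : E (r, (z - x).arg) = z := by
      simp only [hE]
      rw [← hzr, Complex.norm_mul_exp_arg_mul_I]
      ring
    rwa [this]
  have hle : ∀ r ∈ Ioo 0 h, ∀ a : ℝ, sInf (Θ r) ≤ a ↔ ∃ θ ∈ Θ r, θ ≤ a := by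
    intro r hr a
    refine ⟨fun H => ⟨_, (hcomp r).sInf_mem (hne r hr), H⟩, ?_⟩
    rintro ⟨θ, hθ, H⟩
    exact (csInf_le (hcomp r).bddBelow hθ).trans H
  -- The selection takes the least admissible angle. Its sublevel sets are projections of closed
  -- sets along a compact interval of angles, hence closed.
  have hclosed : ∀ a : ℝ, IsClosed {r : ℝ | ∃ θ ∈ Θ r, θ ≤ a} := by
    intro a
    have h1 : IsClosed {p : ℝ × Icc (-Real.pi) Real.pi | E (p.1, p.2) ∈ A ∧ (p.2 : ℝ) ≤ a} :=
      (hA.preimage (by fun_prop)).inter (isClosed_le (continuous_subtype_val.comp continuous_snd) continuous_const)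
    convert isClosedMap_fst_of_compactSpace _ h1 using 1
    ext r
    constructor
    · rintro ⟨θ, ⟨h2, h3⟩, h4⟩
      exact ⟨(r, ⟨θ, h2⟩), ⟨h3, h4⟩, rfl⟩
    · rintro ⟨⟨r', ⟨θ, h2⟩⟩, ⟨h3, h4⟩, rfl⟩
      exact ⟨θ, ⟨h2, h3⟩, h4⟩
  set g : ℝ → ℝ := (Ioo 0 h).indicator fun r => sInf (Θ r) with hg
  have hgm : Measurable g := by
    refine measurable_of_Iic fun a => ?_
    have : g ⁻¹' Iic a = (Ioo 0 h ∩ {r | ∃ θ ∈ Θ r, θ ≤ a}) ∪ ((Ioo 0 h)ᶜ ∩ {_r | 0 ≤ a}) := by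
      ext r
      by_cases hr : r ∈ Ioo 0 h
      · simp only [hg, mem_preimage, indicator_of_mem hr, mem_Iic, mem_union, mem_inter_iff, hr,
          mem_compl_iff, not_true, false_and, or_false, true_and, hle r hr, mem_ofPred_eq]
      · simp only [hg, mem_preimage, indicator_of_notMem hr, mem_Iic, mem_union, mem_inter_iff, hr,
          mem_compl_iff, not_false_iff, false_and, false_or, true_and, mem_ofPred_eq]
    rw [this]
    exact (measurableSet_Ioo.inter (hclosed a).measurableSet).union
      (measurableSet_Ioo.compl.inter (MeasurableSet.const _))
  refine ⟨fun r => E (r, g r), hEc.measurable.comp (measurable_id.prodMk hgm), fun r hr => ?_⟩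
  have hgr : g r ∈ Θ r := by
    rw [hg, indicator_of_mem hr]
    exact (hcomp r).sInf_mem (hne r hr)
  refine ⟨hgr.2, ?_⟩
  simp [hE, Complex.norm_exp_ofReal_mul_I, abs_of_pos hr.1]

/-- A connected set of the sphere that contains `x` and a point outside the disc of radius `h`
about `x` meets all smaller circles about `x`. -/
lemma exists_norm_sub_eq_of_isPreconnected {C : Set Sphere} (hC : IsPreconnected C) {x : ℂ}
    (hx : (x : Sphere) ∈ C) {y : Sphere} (hy : y ∈ C) {h : ℝ}
    (hyx : ∀ z : ℂ, y = z → h ≤ ‖z - x‖) {r : ℝ} (hr : r ∈ Ioo 0 h) :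
    ∃ z : ℂ, (z : Sphere) ∈ C ∧ ‖z - x‖ = r := by
  -- Truncating the distance at `h` makes it continuous at infinity, so the intermediate value
  -- theorem applies on the sphere.
  let ρ : Sphere → ℝ := fun p => p.elim h fun z => min ‖z - x‖ h
  have hρz : ∀ z : ℂ, ρ z = min ‖z - x‖ h := fun z => rfl
  have hρ : Continuous ρ := by
    rw [OnePoint.continuous_iff]
    constructor
    · rw [coclosedCompact_eq_cocompact]
      refine tendsto_const_nhds.congr' ?_
      have h1 : Tendsto (fun z : ℂ => ‖z - x‖) (cocompact ℂ) atTop :=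
        tendsto_norm_cocompact_atTop.comp (Homeomorph.subRight x).isClosedEmbedding.tendsto_cocompact
      filter_upwards [h1.eventually_ge_atTop h] with z hz
      rw [hρz, min_eq_right hz]
      rfl
    · simp only [hρz]
      fun_prop
  have hx0 : ρ x = 0 := by
    rw [hρz, sub_self, norm_zero, min_eq_left (hr.1.trans hr.2).le]
  have hyh : ρ y = h := by
    induction y using OnePoint.rec with
    | infty => rfl
    | coe w => rw [hρz, min_eq_right (hyx w rfl)]
  have hmem : r ∈ Icc (ρ x) (ρ y) := by rw [hx0, hyh]; exact ⟨hr.1.le, hr.2.le⟩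
  obtain ⟨p, hp, hpr⟩ := hC.intermediate_value hx hy hρ.continuousOn hmem
  induction p using OnePoint.rec with
  | infty => exact absurd hpr.symm hr.2.ne
  | coe w =>
    refine ⟨w, hp, ?_⟩
    rw [hρz] at hpr
    rcases min_choice ‖w - x‖ h with h1 | h1 <;> rw [h1] at hpr
    · exact hpr
    · exact absurd hpr.symm hr.2.ne

/-- `G` moves the points of `A` by at most `4 h`, and spreads every point of `A` radially
along an interval of length `h`. -/
structure IsRadialSpread (A : Set ℂ) (h : ℝ) (G : ℂ × ℝ → ℂ) : Prop where
  measurable : Measurable G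
  near : ∀ z ∈ A, ∀ t ∈ Ioo (0 : ℝ) 1, ‖G (z, t) - z‖ ≤ 4 * h
  radial : ∀ z ∈ A, ∃ x : ℂ, ∀ t ∈ Ioo (0 : ℝ) 1, ‖G (z, t) - x‖ = h * t

lemma exists_isRadialSpread {B : Set ℂ} (hB : IsClosed B) {A : Set ℂ} {h : ℝ} (hh : 0 < h)
    (hAB : ∀ p ∈ A, ∃ x : ℂ, ‖x - p‖ < h ∧ ∀ r ∈ Ioo 0 h, ∃ z ∈ B, ‖z - x‖ = r) :
    ∃ G, IsRadialSpread A h G ∧ ∀ z ∈ A, ∀ t ∈ Ioo (0 : ℝ) 1, G (z, t) ∈ B := by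
  -- One centre and one selection per cell of a grid of mesh `h`: with countably many selections,
  -- joint measurability is automatic.
  set q : ℂ → ℤ × ℤ := fun z => (⌊z.re / h⌋, ⌊z.im / h⌋) with hq
  have hqm : Measurable q :=
    (Int.measurable_floor.comp (Complex.measurable_re.div_const h)).prodMk
      (Int.measurable_floor.comp (Complex.measurable_im.div_const h))
  have hqd : ∀ z w : ℂ, q z = q w → ‖z - w‖ ≤ 2 * h := by
    intro z w hzw
    have aux : ∀ a b : ℝ, ⌊a / h⌋ = ⌊b / h⌋ → |a - b| ≤ h := by
      intro a b hab
      have := (Int.abs_sub_lt_one_of_floor_eq_floor hab).le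
      rw [← sub_div, abs_div, abs_of_pos hh, div_le_one hh] at this
      exact this
    have h1 := aux _ _ (congrArg Prod.fst hzw)
    have h2 := aux _ _ (congrArg Prod.snd hzw)
    calc ‖z - w‖ ≤ |(z - w).re| + |(z - w).im| := Complex.norm_le_abs_re_add_abs_im _
      _ ≤ 2 * h := by rw [Complex.sub_re, Complex.sub_im]; linarith
  have hex : ∀ i : ℤ × ℤ, ∃ γ : ℝ → ℂ, Measurable γ ∧ ((∃ p ∈ A, q p = i) → ∃ p ∈ A, q p = i ∧
      ∃ x : ℂ, ‖x - p‖ < h ∧ ∀ r ∈ Ioo 0 h, γ r ∈ B ∧ ‖γ r - x‖ = r) := by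
    intro i
    by_cases hi : ∃ p ∈ A, q p = i
    · obtain ⟨p, hp, hpi⟩ := hi
      obtain ⟨x, hxp, hx⟩ := hAB p hp
      obtain ⟨γ, hγ, hγx⟩ := exists_measurable_radial_selection hB x hx
      exact ⟨γ, hγ, fun _ => ⟨p, hp, hpi, x, hxp, hγx⟩⟩
    · exact ⟨fun _ => 0, measurable_const, fun H => absurd H hi⟩
  choose γ hγm hγ using hex
  have hmem : ∀ t ∈ Ioo (0 : ℝ) 1, h * t ∈ Ioo 0 h := fun t ht =>
    ⟨mul_pos hh ht.1, by nlinarith [ht.2]⟩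
  refine ⟨fun p => γ (q p.1) (h * p.2), ⟨?_, ?_, ?_⟩, ?_⟩
  · have h1 : Measurable fun p : (ℤ × ℤ) × ℝ => γ p.1 p.2 :=
      measurable_from_prod_countable_right hγm
    exact h1.comp ((hqm.comp measurable_fst).prodMk (measurable_snd.const_mul h))
  · intro z hz t ht
    obtain ⟨p, hp, hpi, x, hxp, hx⟩ := hγ (q z) ⟨z, hz, rfl⟩
    have h1 := hqd p z hpi
    have h2 := (hx _ (hmem t ht)).2
    have h3 := (hmem t ht).2
    calc ‖γ (q z) (h * t) - z‖ = ‖(γ (q z) (h * t) - x) + (x - p) + (p - z)‖ := by congr 1; ring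
      _ ≤ ‖γ (q z) (h * t) - x‖ + ‖x - p‖ + ‖p - z‖ := norm_add₃_le
      _ ≤ 4 * h := by linarith
  · intro z hz
    obtain ⟨p, hp, hpi, x, hxp, hx⟩ := hγ (q z) ⟨z, hz, rfl⟩
    exact ⟨x, fun t ht => (hx _ (hmem t ht)).2⟩
  · intro z hz t ht
    obtain ⟨p, hp, hpi, x, hxp, hx⟩ := hγ (q z) ⟨z, hz, rfl⟩
    exact (hx _ (hmem t ht)).1

/-! ### Double integrals against spread measures -/

/-- The uniform probability measure on the unit interval. -/
abbrev unif : Measure ℝ := volume.restrict (Ioo (0 : ℝ) 1)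

instance : IsProbabilityMeasure unif := ⟨by simp⟩

lemma ae_unif : ∀ᵐ t ∂unif, t ∈ Ioo (0 : ℝ) 1 := ae_restrict_mem measurableSet_Ioo

/-- The image of `μ × unif` under a spreading map. -/
def spread (μ : Measure ℂ) (G : ℂ × ℝ → ℂ) : Measure ℂ := (μ.prod unif).map G

/-- Fubini with the spreading parameters innermost: the kernel is averaged before it is compared
with `K z w`, which no pointwise comparison could replace near the diagonal. -/
lemma lintegral_lintegral_spread {K : ℂ → ℂ → ℝ≥0∞} (hK : Measurable (Function.uncurry K))
    (μ : Measure ℂ) [IsProbabilityMeasure μ] {G : ℂ × ℝ → ℂ} (hG : Measurable G) :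
    ∫⁻ x, ∫⁻ y, K x y ∂(spread μ G) ∂(spread μ G) =
      ∫⁻ p, ∫⁻ t, ∫⁻ s, K (G (p.1, t)) (G (p.2, s)) ∂unif ∂unif ∂(μ.prod μ) := by
  have : IsProbabilityMeasure (spread μ G) :=
    Measure.isProbabilityMeasure_map hG.aemeasurable
  have m4 : Measurable fun q : ((ℂ × ℂ) × ℝ) × ℝ => K (G (q.1.1.1, q.1.2)) (G (q.1.1.2, q.2)) :=
    hK.comp (f := fun q : ((ℂ × ℂ) × ℝ) × ℝ => (G (q.1.1.1, q.1.2), G (q.1.1.2, q.2)))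
      (by fun_prop)
  have m3 : Measurable fun q : (ℂ × ℂ) × ℝ => ∫⁻ s, K (G (q.1.1, q.2)) (G (q.1.2, s)) ∂unif :=
    Measurable.lintegral_prod_right' m4
  have m2 : Measurable fun p : ℂ × ℂ =>
      ∫⁻ t, ∫⁻ s, K (G (p.1, t)) (G (p.2, s)) ∂unif ∂unif :=
    Measurable.lintegral_prod_right' m3
  have inner : ∀ x, ∫⁻ y, K x y ∂(spread μ G) = ∫⁻ w, ∫⁻ s, K x (G (w, s)) ∂unif ∂μ := by
    intro x
    have hKx : Measurable (K x) := hK.of_uncurry_left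
    rw [spread, lintegral_map hKx hG]
    exact lintegral_prod _ (hKx.comp hG).aemeasurable
  have mo : Measurable fun x => ∫⁻ w, ∫⁻ s, K x (G (w, s)) ∂unif ∂μ := by
    simp_rw [← inner]
    exact Measurable.lintegral_prod_right' hK
  simp_rw [inner]
  nth_rw 1 [spread]
  rw [lintegral_map mo hG, lintegral_prod _ m2.aemeasurable]
  refine (lintegral_prod _ (mo.comp hG).aemeasurable).trans ?_
  refine lintegral_congr fun z => ?_
  exact lintegral_lintegral_swap
    (m3.comp (f := fun q : ℝ × ℂ => ((z, q.2), q.1)) (by fun_prop)).aemeasurable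

lemma tendsto_lintegral_spread {K : ℂ → ℂ → ℝ≥0∞} (hK : Continuous (Function.uncurry K))
    {μ : Measure ℂ} [IsProbabilityMeasure μ] {A : Set ℂ} (hA : ∀ᵐ z ∂μ, z ∈ A)
    (hdiag : ∀ᵐ p ∂μ.prod μ, p.1 ≠ p.2) (hfin : ∫⁻ z, ∫⁻ w, K z w ∂μ ∂μ ≠ ⊤)
    {h : ℕ → ℝ} (h0 : Tendsto h atTop (𝓝 0)) {G : ℕ → ℂ × ℝ → ℂ}
    (hG : ∀ k, IsRadialSpread A (h k) (G k)) {C : ℝ≥0∞} (hC : C ≠ ⊤)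
    (hbound : ∀ k, ∀ z ∈ A, ∀ w ∈ A, z ≠ w →
      ∫⁻ t, ∫⁻ s, K (G k (z, t)) (G k (w, s)) ∂unif ∂unif ≤ K z w + C) :
    Tendsto (fun k => ∫⁻ x, ∫⁻ y, K x y ∂(spread μ (G k)) ∂(spread μ (G k))) atTop
      (𝓝 (∫⁻ z, ∫⁻ w, K z w ∂μ ∂μ)) := by
  have e : ∫⁻ z, ∫⁻ w, K z w ∂μ ∂μ = ∫⁻ p, K p.1 p.2 ∂(μ.prod μ) :=
    (lintegral_prod _ hK.measurable.aemeasurable).symm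
  rw [e] at hfin ⊢
  simp_rw [fun k => lintegral_lintegral_spread hK.measurable μ (hG k).measurable]
  have hA2 : ∀ᵐ p ∂μ.prod μ, p.1 ∈ A ∧ p.2 ∈ A :=
    (Measure.quasiMeasurePreserving_fst.ae hA).and (Measure.quasiMeasurePreserving_snd.ae hA)
  refine tendsto_lintegral_of_dominated_convergence (fun p => K p.1 p.2 + C) ?_ ?_ ?_ ?_
  · intro k
    have hGk := (hG k).measurable
    have m4 : Measurable fun q : ((ℂ × ℂ) × ℝ) × ℝ =>
        K (G k (q.1.1.1, q.1.2)) (G k (q.1.1.2, q.2)) :=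
      hK.measurable.comp (f := fun q : ((ℂ × ℂ) × ℝ) × ℝ =>
        (G k (q.1.1.1, q.1.2), G k (q.1.1.2, q.2))) (by fun_prop)
    exact Measurable.lintegral_prod_right' (Measurable.lintegral_prod_right' m4)
  · intro k
    filter_upwards [hA2, hdiag] with p hp hd
    exact hbound k _ hp.1 _ hp.2 hd
  · rw [lintegral_add_right _ measurable_const, lintegral_const]
    simpa using ⟨hfin, hC⟩
  · filter_upwards [hA2] with p hp
    have conv : ∀ V ∈ 𝓝 (K p.1 p.2), ∀ᶠ k in atTop, ∀ t ∈ Ioo (0 : ℝ) 1, ∀ s ∈ Ioo (0 : ℝ) 1,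
        K (G k (p.1, t)) (G k (p.2, s)) ∈ V := by
      intro V hV
      obtain ⟨ε, hε, hεV⟩ := Metric.mem_nhds_iff.1 ((hK.tendsto (p.1, p.2)) hV)
      filter_upwards [h0.eventually_lt_const (show (0 : ℝ) < ε / 4 by positivity)] with k hk t ht s hs
      have h1 := (hG k).near _ hp.1 t ht
      have h2 := (hG k).near _ hp.2 s hs
      suffices H : (G k (p.1, t), G k (p.2, s)) ∈ Metric.ball (p.1, p.2) ε from hεV H
      rw [Metric.mem_ball, Prod.dist_eq, max_lt_iff, dist_eq_norm, dist_eq_norm]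
      exact ⟨h1.trans_lt (by linarith), h2.trans_lt (by linarith)⟩
    -- The averages are squeezed between constants, which also covers the value `⊤`.
    rw [tendsto_order]
    constructor
    · intro a ha
      obtain ⟨b, hab, hb⟩ := exists_between ha
      filter_upwards [conv _ (Ioi_mem_nhds hb)] with k hk
      refine hab.trans_le ?_
      calc b = ∫⁻ _t, ∫⁻ _s, b ∂unif ∂unif := by simp
        _ ≤ _ := lintegral_mono_ae (ae_unif.mono fun t ht => lintegral_mono_ae
          (ae_unif.mono fun s hs => (hk t ht s hs).le))
    · intro a ha
      obtain ⟨b, hb, hba⟩ := exists_between ha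
      filter_upwards [conv _ (Iio_mem_nhds hb)] with k hk
      refine lt_of_le_of_lt ?_ hba
      calc _ ≤ ∫⁻ _t, ∫⁻ _s, b ∂unif ∂unif :=
          lintegral_mono_ae (ae_unif.mono fun t ht => lintegral_mono_ae
            (ae_unif.mono fun s hs => (hk t ht s hs).le))
        _ = b := by simp

/-! ### The logarithmic kernel and bounds uniform in the scale -/

/-- The positive part of the logarithmic kernel. -/
def posKernel (z w : ℂ) : ℝ≥0∞ := (logKernel z w).toENNReal

/-- The negative part of the logarithmic kernel. -/
def negKernel (z w : ℂ) : ℝ≥0∞ := (-logKernel z w).toENNReal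

lemma continuous_logKernel : Continuous (Function.uncurry logKernel) := by
  have : Continuous fun p : ℂ × ℂ => ‖p.1 - p.2‖ₑ := by fun_prop
  exact continuous_neg.comp (ENNReal.continuous_log.comp this)

lemma continuous_posKernel : Continuous (Function.uncurry posKernel) :=
  EReal.continuous_toENNReal.comp continuous_logKernel

lemma continuous_negKernel : Continuous (Function.uncurry negKernel) :=
  EReal.continuous_toENNReal.comp (continuous_neg.comp continuous_logKernel)

lemma logKernel_of_ne {z w : ℂ} (hzw : z ≠ w) :
    logKernel z w = ((-Real.log ‖z - w‖ : ℝ) : EReal) := by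
  have : 0 < ‖z - w‖ := norm_pos_iff.2 (sub_ne_zero.2 hzw)
  rw [logKernel, ← ofReal_norm, ENNReal.log_ofReal_of_pos this, EReal.coe_neg]

lemma posKernel_of_ne {z w : ℂ} (hzw : z ≠ w) :
    posKernel z w = ENNReal.ofReal (-Real.log ‖z - w‖) := by
  rw [posKernel, logKernel_of_ne hzw, EReal.real_coe_toENNReal]

lemma posKernel_self (z : ℂ) : posKernel z z = ⊤ := by
  simp [posKernel, logKernel]

lemma negKernel_eq (z w : ℂ) : negKernel z w = ENNReal.ofReal (Real.log ‖z - w‖) := by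
  by_cases hzw : z = w
  · simp [negKernel, logKernel, hzw]
  · rw [negKernel, logKernel_of_ne hzw, ← EReal.coe_neg, neg_neg, EReal.real_coe_toENNReal]

lemma posKernel_le {z w : ℂ} {r : ℝ} (hr : 0 < r) (h : r ≤ ‖z - w‖) :
    posKernel z w ≤ ENNReal.ofReal (-Real.log r) := by
  have hzw : z ≠ w := by
    rintro rfl
    rw [sub_self, norm_zero] at h
    exact hr.not_ge h
  rw [posKernel_of_ne hzw]
  exact ENNReal.ofReal_le_ofReal (neg_le_neg (Real.log_le_log hr h))

/-- The integral of the positive part of `log (1 / |s|)` over the line. -/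
def logMass : ℝ≥0∞ := ∫⁻ s : ℝ, ENNReal.ofReal (-Real.log s)

lemma logMass_ne_top : logMass ≠ ⊤ := by
  have h1 : IntegrableOn (fun s => -Real.log s) (Ioc (-1) 1) :=
    ((intervalIntegrable_iff_integrableOn_Ioc_of_le (by norm_num)).1
      intervalIntegral.intervalIntegrable_log').neg
  refine ne_top_of_le_ne_top h1.lintegral_lt_top.ne ?_
  rw [← lintegral_indicator measurableSet_Ioc]
  refine lintegral_mono fun s => ?_
  by_cases hs : s ∈ Ioc (-1 : ℝ) 1
  · rw [indicator_of_mem hs]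
  · rw [indicator_of_notMem hs, nonpos_iff_eq_zero, ENNReal.ofReal_eq_zero, neg_nonpos,
      ← Real.log_abs]
    refine Real.log_nonneg ?_
    by_contra! h
    exact hs ⟨(abs_lt.1 h).1, (abs_lt.1 h).2.le⟩

lemma lintegral_log_sub (b : ℝ) :
    ∫⁻ s, ENNReal.ofReal (-Real.log (s - b)) ∂unif ≤ logMass := by
  refine (setLIntegral_le_lintegral _ _).trans_eq ?_
  exact lintegral_sub_right_eq_self (fun s => ENNReal.ofReal (-Real.log s)) b

/-- The potential of a radial spread of a point is at most `log (1 / h)` plus a constant. -/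
lemma lintegral_posKernel_radial {h : ℝ} (hh : 0 < h) {γ : ℝ → ℂ} {x : ℂ}
    (hγ : ∀ t ∈ Ioo (0 : ℝ) 1, ‖γ t - x‖ = h * t) (v : ℂ) :
    ∫⁻ s, posKernel v (γ s) ∂unif ≤ ENNReal.ofReal (-Real.log h) + logMass := by
  set b := ‖v - x‖ / h with hb
  have hne : ∀ᵐ s ∂unif, s ≠ b := Measure.ae_ne _ b
  calc ∫⁻ s, posKernel v (γ s) ∂unif
      ≤ ∫⁻ s, (ENNReal.ofReal (-Real.log h) + ENNReal.ofReal (-Real.log (s - b))) ∂unif := by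
        refine lintegral_mono_ae ?_
        filter_upwards [hne, ae_unif] with s hs hs1
        have hpos : 0 < |s - b| := abs_pos.2 (sub_ne_zero.2 hs)
        -- Reverse triangle inequality: only distances to `x` matter, so the problem becomes the
        -- one-dimensional logarithmic potential.
        have h1 : h * |s - b| ≤ ‖v - γ s‖ := by
          have h2 := abs_norm_sub_norm_le (γ s - x) (v - x)
          rw [hγ s hs1, sub_sub_sub_cancel_right, norm_sub_rev (γ s)] at h2
          have h3 : h * s - ‖v - x‖ = h * (s - b) := by rw [hb]; field_simp
          rwa [h3, abs_mul, abs_of_pos hh] at h2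
        refine (posKernel_le (mul_pos hh hpos) h1).trans ?_
        rw [Real.log_mul hh.ne' hpos.ne', Real.log_abs, neg_add]
        exact ENNReal.ofReal_add_le
    _ ≤ ENNReal.ofReal (-Real.log h) + logMass := by
        rw [lintegral_add_left measurable_const, lintegral_const, measure_univ, mul_one]
        gcongr
        exact lintegral_log_sub b

/-- If the points are within `16 * h`, the radial potential bound already suffices, since log (1/h)
exceeds the kernel exponent by at most log 16. Otherwise the two displacements total at most `8 *
h`, less than half the distance, so the spread points stay at least half as far apart. -/
lemma posKernel_spread_bound {A : Set ℂ} {h : ℝ} (hh : 0 < h) {G : ℂ × ℝ → ℂ}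
    (hG : IsRadialSpread A h G) {z w : ℂ} (hz : z ∈ A) (hw : w ∈ A) (hzw : z ≠ w) :
    ∫⁻ t, ∫⁻ s, posKernel (G (z, t)) (G (w, s)) ∂unif ∂unif ≤
      posKernel z w + (ENNReal.ofReal (Real.log 16) + logMass) := by
  have hd : 0 < ‖z - w‖ := norm_pos_iff.2 (sub_ne_zero.2 hzw)
  rcases le_or_gt ‖z - w‖ (16 * h) with hle | hgt
  · obtain ⟨x, hx⟩ := hG.radial w hw
    calc _ ≤ ∫⁻ _t, (ENNReal.ofReal (-Real.log h) + logMass) ∂unif :=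
          lintegral_mono fun t => lintegral_posKernel_radial hh hx _
      _ = ENNReal.ofReal (-Real.log h) + logMass := by simp
      _ ≤ _ := by
        rw [← add_assoc]
        gcongr
        rw [posKernel_of_ne hzw]
        refine le_trans (ENNReal.ofReal_le_ofReal ?_) ENNReal.ofReal_add_le
        have := Real.log_le_log hd hle
        rw [Real.log_mul (by norm_num) hh.ne'] at this
        linarith
  · calc _ ≤ ∫⁻ _t, ∫⁻ _s, ENNReal.ofReal (-Real.log (‖z - w‖ / 2)) ∂unif ∂unif := by
          refine lintegral_mono_ae (ae_unif.mono fun t ht => lintegral_mono_ae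
            (ae_unif.mono fun s hs => posKernel_le (half_pos hd) ?_))
          have h1 := hG.near z hz t ht
          have h2 := hG.near w hw s hs
          have h3 : ‖z - w‖ ≤ ‖G (z, t) - z‖ + ‖G (z, t) - G (w, s)‖ + ‖G (w, s) - w‖ := by
            calc ‖z - w‖ = ‖-(G (z, t) - z) + (G (z, t) - G (w, s)) + (G (w, s) - w)‖ := by
                  congr 1; ring
              _ ≤ _ := by
                  refine norm_add₃_le.trans ?_
                  rw [norm_neg]
          linarith
      _ = ENNReal.ofReal (-Real.log (‖z - w‖ / 2)) := by simp
      _ ≤ posKernel z w + ENNReal.ofReal (Real.log 16) := by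
          rw [posKernel_of_ne hzw]
          refine le_trans (ENNReal.ofReal_le_ofReal ?_) ENNReal.ofReal_add_le
          rw [Real.log_div hd.ne' two_ne_zero]
          have : Real.log 2 ≤ Real.log 16 := Real.log_le_log two_pos (by norm_num)
          linarith
      _ ≤ _ := by
          gcongr
          exact le_self_add

lemma negKernel_spread_bound {A : Set ℂ} {R : ℝ} (hA : ∀ z ∈ A, ‖z‖ ≤ R) {h : ℝ} (hh : h ≤ 1)
    {G : ℂ × ℝ → ℂ} (hG : IsRadialSpread A h G) {z w : ℂ} (hz : z ∈ A) (hw : w ∈ A) :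
    ∫⁻ t, ∫⁻ s, negKernel (G (z, t)) (G (w, s)) ∂unif ∂unif ≤
      negKernel z w + ENNReal.ofReal (2 * R + 8) := by
  calc _ ≤ ∫⁻ _t, ∫⁻ _s, ENNReal.ofReal (2 * R + 8) ∂unif ∂unif := by
        refine lintegral_mono_ae (ae_unif.mono fun t ht => lintegral_mono_ae
            (ae_unif.mono fun s hs => ?_))
        rw [negKernel_eq]
        refine ENNReal.ofReal_le_ofReal ((Real.log_le_self (norm_nonneg _)).trans ?_)
        have h1 := hG.near z hz t ht
        have h2 := hG.near w hw s hs
        have h3 := norm_le_norm_add_norm_sub' (G (z, t)) z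
        have h4 := norm_le_norm_add_norm_sub' (G (w, s)) w
        have h5 := norm_sub_le (G (z, t)) (G (w, s))
        linarith [hA z hz, hA w hw]
    _ = ENNReal.ofReal (2 * R + 8) := by simp
    _ ≤ _ := le_add_self

/-! ### Finite energy and convergence of weighted energies -/

lemma logEnergy_eq (μ : Measure ℂ) : logEnergy μ =
    ((∫⁻ z, ∫⁻ w, posKernel z w ∂μ ∂μ : ℝ≥0∞) : EReal) -
      ((∫⁻ z, ∫⁻ w, negKernel z w ∂μ ∂μ : ℝ≥0∞) : EReal) := rfl

/-- The double integrals of the positive and of the negative part of the kernel are finite. -/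
structure FiniteKernels (μ : Measure ℂ) : Prop where
  pos : ∫⁻ z, ∫⁻ w, posKernel z w ∂μ ∂μ ≠ ⊤
  neg : ∫⁻ z, ∫⁻ w, negKernel z w ∂μ ∂μ ≠ ⊤

lemma FiniteKernels.logEnergy_lt_top {μ : Measure ℂ} (h : FiniteKernels μ) :
    logEnergy μ < ⊤ := by
  rw [logEnergy_eq, sub_eq_add_neg]
  refine EReal.add_lt_top (EReal.coe_ennreal_eq_top_iff.not.2 h.pos) ?_
  rw [Ne, EReal.neg_eq_top_iff]
  exact EReal.coe_ennreal_ne_bot _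

/-- Since |z - w| ≤ (1 + |z|)(1 + |w|), the logarithmic moment controls the negative part; an
infinite positive part would then make the energy `⊤`. -/
lemma Admissible.finiteKernels {φ : Sphere → ℝ} {K : Set Sphere} {μ : Measure ℂ}
    (hμ : Admissible φ K μ) : FiniteKernels μ := by
  have := hμ.isProbability
  set l : ℂ → ℝ≥0∞ := fun z => ENNReal.ofReal (Real.log (1 + ‖z‖)) with hl
  have hlm : Measurable l := by fun_prop
  have neg : ∫⁻ z, ∫⁻ w, negKernel z w ∂μ ∂μ ≠ ⊤ := by
    have hle : ∀ z w, negKernel z w ≤ l z + l w := by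
      intro z w
      rw [negKernel_eq]
      rcases eq_or_ne z w with rfl | hzw
      · simp
      have hd : 0 < ‖z - w‖ := norm_pos_iff.2 (sub_ne_zero.2 hzw)
      refine le_trans (ENNReal.ofReal_le_ofReal ?_) ENNReal.ofReal_add_le
      rw [← Real.log_mul (by positivity) (by positivity)]
      refine Real.log_le_log hd ((norm_sub_le z w).trans ?_)
      nlinarith [mul_nonneg (norm_nonneg z) (norm_nonneg w)]
    refine ne_top_of_le_ne_top ?_ (lintegral_mono fun z => lintegral_mono fun w => hle z w)
    have e : ∀ z, ∫⁻ w, (l z + l w) ∂μ = l z + ∫⁻ w, l w ∂μ := by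
      intro z
      rw [lintegral_add_left measurable_const, lintegral_const, measure_univ, mul_one]
    simp_rw [e]
    rw [lintegral_add_left hlm, lintegral_const, measure_univ, mul_one]
    exact (ENNReal.add_lt_top.2 ⟨hμ.log_integrable, hμ.log_integrable⟩).ne
  refine ⟨fun hpos => ?_, neg⟩
  have h := hμ.finite_energy
  rw [logEnergy_eq, hpos, EReal.coe_ennreal_top,
    EReal.top_sub (EReal.coe_ennreal_eq_top_iff.not.2 neg)] at h
  exact lt_irrefl _ h

lemma FiniteKernels.ae_ne {μ : Measure ℂ} [IsProbabilityMeasure μ] (h : FiniteKernels μ) :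
    ∀ᵐ p ∂μ.prod μ, p.1 ≠ p.2 := by
  have hm := continuous_posKernel.measurable
  have e : ∫⁻ p, Function.uncurry posKernel p ∂(μ.prod μ) ≠ ⊤ := by
    rw [lintegral_prod _ hm.aemeasurable]
    exact h.pos
  filter_upwards [ae_lt_top hm e] with p hp hpp
  rw [Function.uncurry, hpp, posKernel_self] at hp
  exact lt_irrefl _ hp

lemma FiniteKernels.nullMass {μ : Measure ℂ} [IsProbabilityMeasure μ] (h : FiniteKernels μ)
    (a : ℂ) : μ {a} = 0 := by
  have h0 : μ.prod μ ({a} ×ˢ {a}) = 0 := by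
    refine measure_mono_null ?_ h.ae_ne
    rintro ⟨z, w⟩ ⟨hz, hw⟩
    simp only [mem_singleton_iff] at hz hw
    simp [hz, hw]
  rw [Measure.prod_prod] at h0
  exact mul_self_eq_zero.1 h0

/-- Addition in `EReal` is discontinuous only where opposite infinities meet, and finiteness of the
limiting positive part excludes this. -/
lemma tendsto_weightedEnergy {φ : Sphere → ℝ} {ν : ℕ → Measure ℂ} {μ : Measure ℂ}
    (hμ : FiniteKernels μ)
    (hpos : Tendsto (fun k => ∫⁻ z, ∫⁻ w, posKernel z w ∂(ν k) ∂(ν k)) atTop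
      (𝓝 (∫⁻ z, ∫⁻ w, posKernel z w ∂μ ∂μ)))
    (hneg : Tendsto (fun k => ∫⁻ z, ∫⁻ w, negKernel z w ∂(ν k) ∂(ν k)) atTop
      (𝓝 (∫⁻ z, ∫⁻ w, negKernel z w ∂μ ∂μ)))
    (hφ : Tendsto (fun k => ∫ z : ℂ, φ z ∂(ν k)) atTop (𝓝 (∫ z : ℂ, φ z ∂μ))) :
    Tendsto (fun k => weightedEnergy φ (ν k)) atTop (𝓝 (weightedEnergy φ μ)) := by
  have h1 := (continuous_coe_ennreal_ereal.tendsto _).comp hpos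
  have h2 := (continuous_neg.tendsto _).comp ((continuous_coe_ennreal_ereal.tendsto _).comp hneg)
  have h3 := (continuous_coe_real_ereal.tendsto _).comp (hφ.const_mul 2)
  have hP := EReal.coe_ennreal_eq_top_iff.not.2 hμ.pos
  have h12 : Tendsto (fun k => logEnergy (ν k)) atTop (𝓝 (logEnergy μ)) :=
    (EReal.continuousAt_add (Or.inl hP) (Or.inl (EReal.coe_ennreal_ne_bot _))).tendsto.comp
      (h1.prodMk_nhds h2)
  exact (EReal.continuousAt_add (Or.inr (EReal.coe_ne_bot _))
    (Or.inr (EReal.coe_ne_top _))).tendsto.comp (h12.prodMk_nhds h3)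

lemma ae_spread {μ : Measure ℂ} [IsProbabilityMeasure μ] {A : Set ℂ} (hA : ∀ᵐ z ∂μ, z ∈ A)
    {G : ℂ × ℝ → ℂ} (hG : Measurable G) {D : Set ℂ} (hD : MeasurableSet D)
    (hGD : ∀ z ∈ A, ∀ t ∈ Ioo (0 : ℝ) 1, G (z, t) ∈ D) : ∀ᵐ x ∂(spread μ G), x ∈ D := by
  refine (ae_map_iff hG.aemeasurable hD).2 ?_
  filter_upwards [Measure.quasiMeasurePreserving_fst.ae hA,
    Measure.quasiMeasurePreserving_snd.ae ae_unif] with p h1 h2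
  exact hGD _ h1 _ h2

/-! ### Semicontinuity tested on a compactly supported measure -/

/-- If sets `Γ n` contain, at all small scales `h`, points on all circles of radius less than `h`
about points `h`-close to a given point of `A`, then the limit of their equilibrium energies is at
most the total energy of every measure on `A`. -/
lemma le_weightedEnergy_of_isCompact {φ : Sphere → ℝ} {U : Set ℂ} (hU : IsOpen U)
    (hφ : ContinuousOn (fun z : ℂ => φ z) U) {A : Set ℂ} (hA : IsCompact A) (hAU : A ⊆ U)
    {μ : Measure ℂ} [IsProbabilityMeasure μ] (hμA : ∀ᵐ z ∂μ, z ∈ A) (hμ : FiniteKernels μ)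
    {Γ : ℕ → Set Sphere} (hΓ : ∀ n, IsCompact (Γ n)) {h₀ : ℝ} (hh₀ : 0 < h₀)
    (hcirc : ∀ h ∈ Ioo 0 h₀, ∀ᶠ n in atTop, ∀ p ∈ A, ∃ x : ℂ, ‖x - p‖ < h ∧
      ∀ r ∈ Ioo 0 h, ∃ z : ℂ, (z : Sphere) ∈ Γ n ∧ ‖z - x‖ = r)
    {L : EReal} (hL : Tendsto (fun n => equilibriumEnergy φ (Γ n)) atTop (𝓝 L)) :
    L ≤ weightedEnergy φ μ := by
  obtain ⟨δ, hδ, hδU⟩ := hA.exists_cthickening_subset_open hU hAU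
  set D := Metric.cthickening δ A with hDdef
  have hD : IsCompact D := hA.cthickening
  have hAD : A ⊆ D := Metric.self_subset_cthickening A
  -- The three bounds serve `hcirc`, the estimate of the negative kernel, and displacements of at
  -- most `4 * h` that must stay in `D`.
  set η := min (min (h₀ / 2) 1) (δ / 4) with hη
  have hη0 : 0 < η := by positivity
  set h : ℕ → ℝ := fun k => η / (k + 1) with hh
  have hpos : ∀ k, 0 < h k := fun k => by positivity
  have hle : ∀ k, h k ≤ η := fun k => div_le_self hη0.le (by linarith [k.cast_nonneg (α := ℝ)])
  have hη1 : η ≤ h₀ / 2 := (min_le_left _ _).trans (min_le_left _ _)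
  have hη2 : η ≤ 1 := (min_le_left _ _).trans (min_le_right _ _)
  have hη3 : η ≤ δ / 4 := min_le_right _ _
  have htend : Tendsto h atTop (𝓝 0) := by
    simpa [hh, div_eq_mul_inv] using tendsto_one_div_add_atTop_nhds_zero_nat.const_mul η
  have hBcl : ∀ n, IsClosed {z : ℂ | (z : Sphere) ∈ Γ n} := fun n =>
    (hΓ n).isClosed.preimage OnePoint.continuous_coe
  -- Diagonal choice: the index is at least `k`, so the energies along it still tend to `L`.
  have hex : ∀ k : ℕ, ∃ n, k ≤ n ∧ ∃ G, IsRadialSpread A (h k) G ∧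
      ∀ z ∈ A, ∀ t ∈ Ioo (0 : ℝ) 1, G (z, t) ∈ {z : ℂ | (z : Sphere) ∈ Γ n} := by
    intro k
    have := hle k
    obtain ⟨n, hn, hkn⟩ := ((hcirc (h k) ⟨hpos k, by linarith⟩).and (eventually_ge_atTop k)).exists
    exact ⟨n, hkn, exists_isRadialSpread (hBcl n) (hpos k) hn⟩
  choose n hn G hG hGΓ using hex
  have hprob : ∀ k, IsProbabilityMeasure (spread μ (G k)) := fun k =>
    Measure.isProbabilityMeasure_map (hG k).measurable.aemeasurable
  have hGD : ∀ k, ∀ z ∈ A, ∀ t ∈ Ioo (0 : ℝ) 1, G k (z, t) ∈ D := by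
    intro k z hz t ht
    refine Metric.mem_cthickening_of_dist_le _ z _ _ hz ?_
    rw [dist_eq_norm]
    linarith [(hG k).near z hz t ht, hle k]
  have hDae : ∀ k, ∀ᵐ x ∂(spread μ (G k)), x ∈ D := fun k =>
    ae_spread hμA (hG k).measurable hD.measurableSet (hGD k)
  have hφint : ∀ k, Integrable (fun z : ℂ => φ z) (spread μ (G k)) := by
    intro k
    have := (hφ.mono hδU).integrableOn_compact (μ := spread μ (G k)) hD
    rwa [IntegrableOn, Measure.restrict_eq_self_of_ae_mem (hDae k)] at this
  obtain ⟨R, hR⟩ := hD.isBounded.exists_norm_le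
  have tpos : Tendsto (fun k => ∫⁻ x, ∫⁻ y, posKernel x y ∂(spread μ (G k)) ∂(spread μ (G k)))
      atTop (𝓝 (∫⁻ z, ∫⁻ w, posKernel z w ∂μ ∂μ)) :=
    tendsto_lintegral_spread continuous_posKernel hμA hμ.ae_ne hμ.pos htend hG
      (ENNReal.add_ne_top.2 ⟨ENNReal.ofReal_ne_top, logMass_ne_top⟩)
      fun k z hz w hw hzw => posKernel_spread_bound (hpos k) (hG k) hz hw hzw
  have tneg : Tendsto (fun k => ∫⁻ x, ∫⁻ y, negKernel x y ∂(spread μ (G k)) ∂(spread μ (G k)))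
      atTop (𝓝 (∫⁻ z, ∫⁻ w, negKernel z w ∂μ ∂μ)) :=
    tendsto_lintegral_spread continuous_negKernel hμA hμ.ae_ne hμ.neg htend hG
      ENNReal.ofReal_ne_top fun k z hz w hw _ => negKernel_spread_bound
        (fun z hz => hR z (hAD hz)) ((hle k).trans hη2) (hG k) hz hw
  have tφ : Tendsto (fun k => ∫ z : ℂ, φ z ∂(spread μ (G k))) atTop (𝓝 (∫ z : ℂ, φ z ∂μ)) := by
    obtain ⟨M, hM⟩ := hD.exists_bound_of_continuousOn (hφ.mono hδU)
    have e1 : ∀ k, ∫ z : ℂ, φ z ∂(spread μ (G k)) =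
        ∫ p, φ (G k p : ℂ) ∂(μ.prod unif) := fun k =>
      integral_map (hG k).measurable.aemeasurable (hφint k).aestronglyMeasurable
    have e2 : ∫ z : ℂ, φ z ∂μ = ∫ p : ℂ × ℝ, φ (p.1 : ℂ) ∂(μ.prod unif) := by
      rw [integral_fun_fst (fun z : ℂ => φ z)]
      simp
    simp_rw [e1]
    rw [e2]
    have hae : ∀ᵐ p ∂(μ.prod unif), p.1 ∈ A ∧ p.2 ∈ Ioo (0 : ℝ) 1 :=
      (Measure.quasiMeasurePreserving_fst.ae hμA).and
        (Measure.quasiMeasurePreserving_snd.ae ae_unif)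
    refine tendsto_integral_of_dominated_convergence (fun _ => M) (fun k => ?_)
      (integrable_const M) (fun k => ?_) ?_
    · exact (hφint k).aestronglyMeasurable.comp_aemeasurable (hG k).measurable.aemeasurable
    · filter_upwards [hae] with p hp
      exact hM _ (hGD k _ hp.1 _ hp.2)
    · filter_upwards [hae] with p hp
      have hc : ContinuousAt (fun z : ℂ => φ z) p.1 := hφ.continuousAt (hU.mem_nhds (hAU hp.1))
      have hGt : Tendsto (fun k => G k p) atTop (𝓝 p.1) := by
        rw [tendsto_iff_norm_sub_tendsto_zero]
        refine squeeze_zero (fun _ => norm_nonneg _) (fun k => (hG k).near _ hp.1 _ hp.2) ?_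
        simpa using htend.const_mul 4
      exact hc.tendsto.comp hGt
  have hfin : ∀ᶠ k in atTop, FiniteKernels (spread μ (G k)) := by
    filter_upwards [tpos.eventually_lt_const hμ.pos.lt_top,
      tneg.eventually_lt_const hμ.neg.lt_top] with k h1 h2
    exact ⟨h1.ne, h2.ne⟩
  refine le_of_tendsto_of_tendsto (hL.comp (tendsto_atTop_mono hn tendsto_id))
    (tendsto_weightedEnergy hμ tpos tneg tφ) ?_
  filter_upwards [hfin] with k hk
  refine iInf₂_le _ ⟨hprob k, ?_, ?_, hk.logEnergy_lt_top, hφint k⟩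
  · exact ae_spread hμA (hG k).measurable (hBcl (n k)).measurableSet (hGΓ k)
  · calc ∫⁻ z, ENNReal.ofReal (Real.log (1 + ‖z‖)) ∂(spread μ (G k))
        ≤ ∫⁻ _z, ENNReal.ofReal R ∂(spread μ (G k)) := by
          refine lintegral_mono_ae ?_
          filter_upwards [hDae k] with z hz
          refine ENNReal.ofReal_le_ofReal ?_
          have := Real.log_le_sub_one_of_pos (show 0 < 1 + ‖z‖ by positivity)
          linarith [hR z hz]
      _ < ⊤ := by simp

/-! ### Exhaustion by conditional measures -/

/-- The conditional measures on an exhausting sequence have convergent double integrals. -/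
lemma tendsto_lintegral_cond {K : ℂ → ℂ → ℝ≥0∞} (hK : Measurable (Function.uncurry K))
    {μ : Measure ℂ} [IsProbabilityMeasure μ] {B : ℕ → Set ℂ} (hB : Monotone B)
    (hμB : ∀ᵐ z ∂μ, z ∈ ⋃ m, B m) :
    Tendsto (fun m => ∫⁻ z, ∫⁻ w, K z w ∂((μ (B m))⁻¹ • μ.restrict (B m))
      ∂((μ (B m))⁻¹ • μ.restrict (B m))) atTop (𝓝 (∫⁻ z, ∫⁻ w, K z w ∂μ ∂μ)) := by
  have hU : μ (⋃ m, B m) = 1 := by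
    rw [← measure_univ (μ := μ)]
    exact measure_congr (eventuallyEq_univ.2 hμB)
  have tc : Tendsto (fun m => (μ (B m))⁻¹) atTop (𝓝 1) := by
    have := (tendsto_measure_iUnion_atTop (μ := μ) hB).inv
    rwa [hU, inv_one] at this
  have tK : Tendsto (fun m => ∫⁻ z in B m, ∫⁻ w in B m, K z w ∂μ ∂μ) atTop
      (𝓝 (∫⁻ z, ∫⁻ w, K z w ∂μ ∂μ)) := by
    have e1 : ∀ m, ∫⁻ z in B m, ∫⁻ w in B m, K z w ∂μ ∂μ =
        ∫⁻ p in B m ×ˢ B m, Function.uncurry K p ∂(μ.prod μ) := by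
      intro m
      rw [← Measure.prod_restrict, lintegral_prod _ hK.aemeasurable]
      rfl
    have e2 : ∫⁻ z, ∫⁻ w, K z w ∂μ ∂μ =
        ∫⁻ p in ⋃ m, B m ×ˢ B m, Function.uncurry K p ∂(μ.prod μ) := by
      have hae : (⋃ m, B m ×ˢ B m) =ᵐ[μ.prod μ] univ := by
        rw [eventuallyEq_univ]
        filter_upwards [Measure.quasiMeasurePreserving_fst.ae hμB,
          Measure.quasiMeasurePreserving_snd.ae hμB] with p h1 h2
        obtain ⟨i, hi⟩ := mem_iUnion.1 h1
        obtain ⟨j, hj⟩ := mem_iUnion.1 h2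
        exact mem_iUnion.2 ⟨max i j, hB (le_max_left i j) hi, hB (le_max_right i j) hj⟩
      rw [setLIntegral_congr hae, setLIntegral_univ, lintegral_prod _ hK.aemeasurable]
      rfl
    have hmono : Monotone fun m => B m ×ˢ B m := fun i j hij => prod_mono (hB hij) (hB hij)
    simp_rw [e1]
    rw [e2, setLIntegral_iUnion_of_directed _ hmono.directed_le]
    exact tendsto_atTop_iSup fun i j hij => lintegral_mono_set (hmono hij)
  have tcK := ENNReal.Tendsto.mul tc (Or.inl one_ne_zero)
    (ENNReal.Tendsto.mul tc (Or.inl one_ne_zero) tK (Or.inr ENNReal.one_ne_top))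
    (Or.inr ENNReal.one_ne_top)
  rw [one_mul, one_mul] at tcK
  refine tcK.congr' ?_
  filter_upwards [tc.eventually_lt_const ENNReal.one_lt_top] with m hm
  simp only [lintegral_smul_measure, smul_eq_mul]
  rw [lintegral_const_mul' _ _ hm.ne]

lemma tendsto_weightedEnergy_cond {φ : Sphere → ℝ} {μ : Measure ℂ} [IsProbabilityMeasure μ]
    (hμ : FiniteKernels μ) (hφ : Integrable (fun z : ℂ => φ z) μ) {B : ℕ → Set ℂ}
    (hBm : ∀ m, MeasurableSet (B m)) (hB : Monotone B) (hμB : ∀ᵐ z ∂μ, z ∈ ⋃ m, B m) :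
    Tendsto (fun m => weightedEnergy φ ((μ (B m))⁻¹ • μ.restrict (B m))) atTop
      (𝓝 (weightedEnergy φ μ)) := by
  refine tendsto_weightedEnergy hμ
    (tendsto_lintegral_cond continuous_posKernel.measurable hB hμB)
    (tendsto_lintegral_cond continuous_negKernel.measurable hB hμB) ?_
  have hU : μ (⋃ m, B m) = 1 := by
    rw [← measure_univ (μ := μ)]
    exact measure_congr (eventuallyEq_univ.2 hμB)
  have tc : Tendsto (fun m => (μ (B m))⁻¹.toReal) atTop (𝓝 1) := by
    have := (tendsto_measure_iUnion_atTop (μ := μ) hB).inv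
    rw [hU, inv_one] at this
    exact (ENNReal.tendsto_toReal ENNReal.one_ne_top).comp this
  have tI := tendsto_setIntegral_of_monotone hBm hB hφ.integrableOn
  rw [Measure.restrict_eq_self_of_ae_mem hμB] at tI
  simp_rw [integral_smul_measure]
  simpa using tc.mul tI

lemma FiniteKernels.cond {μ : Measure ℂ} (hμ : FiniteKernels μ) {B : Set ℂ} (hB : μ B ≠ 0) :
    FiniteKernels ((μ B)⁻¹ • μ.restrict B) := by
  have hc : (μ B)⁻¹ ≠ ⊤ := ENNReal.inv_ne_top.2 hB
  have key : ∀ K : ℂ → ℂ → ℝ≥0∞, ∫⁻ z, ∫⁻ w, K z w ∂μ ∂μ ≠ ⊤ →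
      ∫⁻ z, ∫⁻ w, K z w ∂((μ B)⁻¹ • μ.restrict B) ∂((μ B)⁻¹ • μ.restrict B) ≠ ⊤ := by
    intro K hK
    simp only [lintegral_smul_measure, smul_eq_mul]
    rw [lintegral_const_mul' _ _ hc]
    refine ENNReal.mul_ne_top hc (ENNReal.mul_ne_top hc (ne_top_of_le_ne_top hK ?_))
    exact (setLIntegral_le_lintegral _ _).trans
      (lintegral_mono fun z => setLIntegral_le_lintegral _ _)
  exact ⟨key _ hμ.pos, key _ hμ.neg⟩

/-! ### Base points of components and upper semicontinuity -/

/-- A set with at most `s` components has `s` base points, one of them in every component. -/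
lemma exists_basePoints {Γ : Set Sphere} (hne : Γ.Nonempty) {s : ℕ}
    (hs : ENat.card (ConnectedComponents Γ) ≤ s) :
    ∃ c : Fin s → Sphere, ∀ x ∈ Γ, ∃ j, ∃ C ⊆ Γ, IsPreconnected C ∧ x ∈ C ∧ c j ∈ C := by
  have : Nonempty Γ := hne.to_subtype
  have : Nonempty (ConnectedComponents Γ) := ‹Nonempty Γ›.map ConnectedComponents.mk
  have : Finite (ConnectedComponents Γ) :=
    ENat.card_lt_top.1 (hs.trans_lt (ENat.natCast_lt_top s))
  have hs' : Nat.card (ConnectedComponents Γ) ≤ s := by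
    rw [ENat.card_eq_coe_natCard] at hs
    exact_mod_cast hs
  let ι : ConnectedComponents Γ → Fin s := fun C => Fin.castLE hs' (Finite.equivFin _ C)
  have hinj : Function.Injective ι :=
    (Fin.castLE_injective hs').comp (Finite.equivFin _).injective
  set b := Function.surjInv (ConnectedComponents.surjective_coe (α := Γ)) with hb
  -- Indices that label no component receive an arbitrary base point, which is harmless.
  refine ⟨fun j => (b (Function.invFun ι j) : Sphere), fun x hx => ?_⟩
  obtain ⟨j, hj⟩ := Function.invFun_surjective hinj (ConnectedComponents.mk ⟨x, hx⟩)
  refine ⟨j, (↑) '' connectedComponent (⟨x, hx⟩ : Γ), Subtype.coe_image_subset _ _,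
    isPreconnected_connectedComponent.image _ continuous_subtype_val.continuousOn,
    ⟨_, mem_connectedComponent, rfl⟩, ⟨_, ?_, rfl⟩⟩
  rw [← ConnectedComponents.coe_eq_coe', hb, hj]
  exact Function.surjInv_eq _ _

/-- The equilibrium energy is upper semicontinuous along Hausdorff convergent sequences of sets
with a bounded number of components. -/
lemma le_equilibriumEnergy_of_tendsto {φ : Sphere → ℝ} {e : Set Sphere} (he : e.Finite)
    (hφ : HarmonicOnSphere φ eᶜ) {Γ : ℕ → Set Sphere} (hΓ : ∀ n, IsCompact (Γ n))
    {S : Set Sphere} (hS : IsCompact S)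
    (hΓS : ∀ ε : ℝ, 0 < ε → ∀ᶠ n in atTop, S ⊆ chordalNhd (Γ n) ε)
    {s : ℕ} {c : ℕ → Fin s → Sphere}
    (hc : ∀ n, ∀ x ∈ Γ n, ∃ j, ∃ C ⊆ Γ n, IsPreconnected C ∧ x ∈ C ∧ c n j ∈ C)
    {b : Fin s → Sphere} (hb : Tendsto c atTop (𝓝 b))
    {L : EReal} (hL : Tendsto (fun n => equilibriumEnergy φ (Γ n)) atTop (𝓝 L)) :
    L ≤ equilibriumEnergy φ S := by
  refine le_iInf₂ fun μ hμ => ?_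
  have := hμ.isProbability
  have hμK := hμ.finiteKernels
  -- The limits of the base points are removed too: a component may shrink to such a point and then
  -- meets no circle of fixed radius about it. As `F` is finite, it is null for a measure of finite
  -- energy.
  set F : Set ℂ := {z | (z : Sphere) ∈ e ∪ range b} with hF
  have hFfin : F.Finite :=
    (he.union (finite_range b)).preimage OnePoint.coe_injective.injOn
  have hφF : ContinuousOn (fun z : ℂ => φ z) Fᶜ := fun z hz =>
    (hφ.1 z fun h => hz (Or.inl h)).1.continuousAt.continuousWithinAt
  set B : ℕ → Set ℂ := fun m => {z | ‖z‖ ≤ m ∧ ∀ f ∈ F, 1 / ((m : ℝ) + 1) ≤ ‖z - f‖} with hB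
  have hBcl : ∀ m, IsClosed (B m) := by
    intro m
    have : B m = {z | ‖z‖ ≤ m} ∩ ⋂ f ∈ F, {z | 1 / ((m : ℝ) + 1) ≤ ‖z - f‖} := by
      ext z
      simp [hB]
    rw [this]
    exact (isClosed_le (by fun_prop) (by fun_prop)).inter
      (isClosed_biInter fun f _ => isClosed_le (by fun_prop) (by fun_prop))
  have hBmono : Monotone B := by
    intro i j hij z hz
    have hij' : (i : ℝ) ≤ j := by exact_mod_cast hij
    refine ⟨hz.1.trans hij', fun f hf => le_trans ?_ (hz.2 f hf)⟩
    gcongr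
  have hBU : ∀ᵐ z ∂μ, z ∈ ⋃ m, B m := by
    have hF0 : ∀ᵐ z ∂μ, z ∉ F := by
      have : μ F = 0 := by
        rw [← biUnion_of_singleton F, measure_biUnion_null_iff hFfin.countable]
        exact fun f _ => hμK.nullMass f
      exact compl_mem_ae_iff.2 this
    filter_upwards [hF0] with z hz
    have h1 : ∀ᶠ m : ℕ in atTop, ‖z‖ ≤ m := tendsto_natCast_atTop_atTop.eventually_ge_atTop _
    have h2 : ∀ᶠ m : ℕ in atTop, ∀ f ∈ F, 1 / ((m : ℝ) + 1) ≤ ‖z - f‖ := by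
      rw [hFfin.eventually_all]
      intro f hf
      have : 0 < ‖z - f‖ := norm_pos_iff.2 (sub_ne_zero.2 fun h => hz (h ▸ hf))
      exact (tendsto_one_div_add_atTop_nhds_zero_nat.eventually_lt_const this).mono
        fun _ h => h.le
    obtain ⟨m, hm⟩ := (h1.and h2).exists
    exact mem_iUnion.2 ⟨m, hm⟩
  refine ge_of_tendsto (tendsto_weightedEnergy_cond hμK hμ.field_integrable
    (fun m => (hBcl m).measurableSet) hBmono hBU) ?_
  have hpos : ∀ᶠ m in atTop, μ (B m) ≠ 0 := by
    have hU : μ (⋃ m, B m) = 1 := by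
      rw [← measure_univ (μ := μ)]
      exact measure_congr (eventuallyEq_univ.2 hBU)
    have := tendsto_measure_iUnion_atTop (μ := μ) hBmono
    rw [hU] at this
    exact (this.eventually_const_lt one_pos).mono fun _ h => h.ne'
  filter_upwards [hpos] with m hm
  set A : Set ℂ := B m ∩ {z | (z : Sphere) ∈ S} with hAdef
  have hScl : IsClosed {z : ℂ | (z : Sphere) ∈ S} :=
    hS.isClosed.preimage OnePoint.continuous_coe
  have hA : IsCompact A := by
    refine Metric.isCompact_of_isClosed_isBounded ((hBcl m).inter hScl) ?_
    exact (Metric.isBounded_closedBall (x := (0 : ℂ)) (r := m)).subset fun z hz => by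
      simpa using hz.1.1
  have hprob : IsProbabilityMeasure ((μ (B m))⁻¹ • μ.restrict (B m)) := by
    refine ⟨?_⟩
    simp [ENNReal.inv_mul_cancel hm (measure_ne_top μ _)]
  have hae : ∀ᵐ z ∂((μ (B m))⁻¹ • μ.restrict (B m)), z ∈ A := by
    refine Measure.ae_smul_measure ?_ _
    have h1 : ∀ᵐ z : ℂ ∂μ, (z : Sphere) ∈ S := hμ.supported
    filter_upwards [ae_restrict_mem (hBcl m).measurableSet, ae_restrict_of_ae h1] with z h2 h3
    exact ⟨h2, h3⟩
  have hd : (0 : ℝ) < 1 / ((m : ℝ) + 1) := by positivity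
  refine le_weightedEnergy_of_isCompact hFfin.isClosed.isOpen_compl hφF hA ?_ hae
    (hμK.cond hm) hΓ (half_pos hd) ?_ hL
  · intro z hz hzF
    have := hz.1.2 z hzF
    rw [sub_self, norm_zero] at this
    exact hd.not_ge this
  · rintro h ⟨hh0, hh⟩
    obtain ⟨δ, hδ, hδA⟩ := exists_chordal_radius m h hh0
    set D := Metric.cthickening (2 * h) A with hD
    have hDc : IsCompact D := hA.cthickening
    have hDcl : IsClosed ((↑) '' D : Set Sphere) :=
      (hDc.image OnePoint.continuous_coe).isClosed
    -- Points of `A` have distance at least `1 / (m + 1) > 2 * h` from `F`, so no limit `b j` lies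
    -- in `D`. A base point within `h` of `x` would be within `2 * h` of `p`, hence in `D`.
    have hfar : ∀ᶠ n in atTop, ∀ j, c n j ∉ ((↑) '' D : Set Sphere) := by
      rw [eventually_all]
      intro j
      refine (tendsto_pi_nhds.1 hb j) (hDcl.isOpen_compl.mem_nhds ?_)
      rintro ⟨z, hz, hzb⟩
      rw [hD, hA.cthickening_eq_biUnion_closedBall (by positivity)] at hz
      obtain ⟨a, ha, haz⟩ := mem_iUnion₂.1 hz
      have h1 := ha.1.2 z (Or.inr ⟨j, hzb.symm⟩)
      rw [Metric.mem_closedBall, dist_comm, dist_eq_norm] at haz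
      linarith
    filter_upwards [hΓS δ hδ, hfar] with n hn hfarn p hp
    obtain ⟨y, hy, hpy⟩ := hn hp.2
    obtain ⟨x, rfl, hxp⟩ := hδA p hp.1.1 y hpy
    obtain ⟨j, C, hCΓ, hC, hxC, hcC⟩ := hc n _ hy
    refine ⟨x, hxp, fun r hr => ?_⟩
    have hcx : ∀ z : ℂ, c n j = z → h ≤ ‖z - x‖ := by
      intro z hz
      by_contra! hlt
      refine hfarn j ⟨z, Metric.mem_cthickening_of_dist_le z p _ _ hp ?_, hz.symm⟩
      rw [dist_eq_norm]
      have := norm_sub_le_norm_sub_add_norm_sub z x p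
      linarith
    obtain ⟨z, hz, hzr⟩ := exists_norm_sub_eq_of_isPreconnected hC hxC hcC hcx hr
    exact ⟨z, hCΓ hz, hzr⟩

end MaxMinEnergy

end

theorem corollary3p3
    (φ : MaxMinEnergy.Sphere → ℝ) (e : Set MaxMinEnergy.Sphere) (he : e.Finite)
    (hφ : MaxMinEnergy.HarmonicOnSphere φ eᶜ)
    (T : Set (Set MaxMinEnergy.Sphere))
    (hT_compact : ∀ Γ ∈ T, IsCompact Γ ∧ Γ.Nonempty)
    (hT_closed : MaxMinEnergy.HausdorffClosed T)
    (s : ℕ) (hT_components : ∀ Γ ∈ T, ENat.card (ConnectedComponents Γ) ≤ s)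
    (h_nondegenerate : ∃ Γ ∈ T, ⊥ < MaxMinEnergy.equilibriumEnergy φ Γ)
    (h_bounded : (⨆ Γ ∈ T, MaxMinEnergy.equilibriumEnergy φ Γ) < ⊤) :
    ∃ S ∈ T, MaxMinEnergy.equilibriumEnergy φ S =
      (⨆ Γ ∈ T, MaxMinEnergy.equilibriumEnergy φ Γ) := by
  obtain ⟨Γ₀, hΓ₀, -⟩ := h_nondegenerate
  obtain ⟨u, -, hu, huT⟩ := exists_seq_tendsto_sSup
    (S := MaxMinEnergy.equilibriumEnergy φ '' T) ⟨_, Set.mem_image_of_mem _ hΓ₀⟩ (OrderTop.bddAbove _)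
  choose Γ hΓT hΓu using huT
  rw [sSup_image] at hu
  obtain ⟨S, hS, hSne, ψ, hψ, hconv⟩ :=
    MaxMinEnergy.exists_subseq_hausdorff Γ fun n => hT_compact _ (hΓT n)
  have hST : S ∈ T := hT_closed S hS hSne fun ε hε => by
    obtain ⟨n, hn⟩ := (hconv ε hε).exists
    exact ⟨_, hΓT _, hn.1⟩
  refine ⟨S, hST, le_antisymm (le_iSup₂_of_le S hST le_rfl) ?_⟩
  choose c hc using fun n => MaxMinEnergy.exists_basePoints (hT_compact _ (hΓT (ψ n))).2
    (hT_components _ (hΓT (ψ n)))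
  -- Needed for sequential compactness of `Fin s → Sphere`, from which all base points converge
  -- along one subsequence.
  have : FirstCountableTopology MaxMinEnergy.Sphere :=
    MaxMinEnergy.isEmbedding_stereo.firstCountableTopology
  obtain ⟨b, θ, hθ, hb⟩ := CompactSpace.tendsto_subseq c
  refine MaxMinEnergy.le_equilibriumEnergy_of_tendsto he hφ (Γ := fun n => Γ (ψ (θ n)))
    (fun n => (hT_compact _ (hΓT _)).1) hS
    (fun ε hε => hθ.tendsto_atTop.eventually ((hconv ε hε).mono fun _ h => h.2))
    (fun n => hc (θ n)) hb ?_
  simp_rw [hΓu]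
  exact hu.comp (hψ.comp hθ).tendsto_atTop
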